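/- All Boolean algebras have $0$ and $1$ (possibly $0=1$); $a^*$ denotes the complement of $a$. A *contact relation* on a Boolean algebra $B$ is a binary relation $\rho$ such that: $a\ne 0$ implies $a\rho a$; $a\rho b$ implies $a\ne 0$ and $b\neq 0$; $a\rho b$ implies $b\rho a$; and $a\rho(b\vee c)$ iff $a\rho b$ or $a\rho c$. Write $a\ll_\rho b$ if $a\rho b^*$ fails. A *complete local contact algebra* (CLCA) is a triple $(B,\rho,\mathbb B)$, where $B$ is a complete Boolean algebra, $\rho$ is a contact relation on $B$ and $\mathbb B$ is a (possibly non-proper) ideal of $B$, such that: (BC1) if $a\in\mathbb B$, $c\in B$ and $a\ll_\rho c$, then $a\ll_\rho b\ll_\rho c$ for some $b\in\mathbb B$; (BC2) if $a\rho b$, then $a\rho(c\wedge b)$ for some $c\in\mathbb B$; (BC3) if $a\ne0$, then $b\ll_\rho a$ for some $b\in\mathbb B\setminus\{0\}$. A *$\delta$-ideal* of $(B,\rho,\mathbb B)$ is an ideal $I$ of $B$ with $I\subseteq\mathbb B$ such that for every $a\in I$ there is $b\in I$ with $a\ll_\rho b$. The $\delta$-ideals, ordered by inclusion, form a complete lattice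 $I(B,\rho,\mathbb B)$ (in fact a frame), in which $\wedge$ and $\bigvee$ below are taken. Let $\mathbf{MDHLC}$ be the category whose objects are all CLCAs, and whose morphisms $\varphi:(A,\rho,\mathbb B)\to(B,\eta,\mathbb B')$ are the multi-valued maps assigning to each $a\in A$ a subset $\varphi(a)\subseteq B$ such that: (M1) $\varphi(a)\in I(B,\eta,\mathbb B')$ for every $a\in A$; (M2) $\varphi(a\wedge b)=\varphi(a)\wedge\varphi(b)$ for all $a,b\in A$; (M3) $\varphi(a)=\bigvee\{\varphi(b) : b\in\mathbb B,\ b\ll_\rho a\}$ for every $a\in A$; (M4) $\varphi(0)=\{0\}$; (M5) if $a_i,b_i\in\mathbb B$ and $a_i\ll_\rho b_i$ for $i=1,2$, then $\varphi(a_1\vee a_2)\subseteq\varphi(b_1)\vee\varphi(b_2)$; (M6) for every $b\in\mathbb B'$ there is $a\in\mathbb B$ with $b\in\varphi(a)$. The composition of $\varphi:(A_1,\rho_1,\mathbb B_1)\to(A_2,\rho_2,\mathbb B_2)$ and $\psi:(A_2,\rho_2,\mathbb B_2)\to(A_3,\rho_3,\mathbb B_3)$ is $(\psi\diamond\varphi)(a)=\bigvee\{\psi(b)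 : b\in\varphi(a)\}$, and the identity of $(A,\rho,\mathbb B)$ is $a\mapsto\{b\in\mathbb B : b\ll_\rho a\}$. Let $\mathbf{HLC}$ be the category of all locally compact Hausdorff spaces and all continuous maps. **Theorem.** The categories $\mathbf{HLC}$ and $\mathbf{MDHLC}$ are dually equivalent, that is, $\mathbf{HLC}^{\mathrm{op}}$ and $\mathbf{MDHLC}$ are equivalent categories. -/

import Mathlib

open CategoryTheory

universe u

/-- `C` is a contact relation on the Boolean algebra `B`. -/
structure IsContact {B : Type u} [BooleanAlgebra B] (C : B → B → Prop) : Prop where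
  /-- (C1) -/
  refl : ∀ a, a ≠ ⊥ → C a a
  /-- (C2) -/
  ne_bot : ∀ a b, C a b → a ≠ ⊥ ∧ b ≠ ⊥
  /-- (C3) -/
  symm : ∀ a b, C a b → C b a
  /-- (C4) -/
  sup_iff : ∀ a b c, C a (b ⊔ c) ↔ C a b ∨ C a c

/-- Non-tangential inclusion `a ≪ b`: `a` is not in contact with the complement of `b`. -/
def NonTangential {B : Type u} [BooleanAlgebra B] (C : B → B → Prop) (a b : B) : Prop :=
  ¬ C a bᶜ

/-- A local contact algebra structure on a Boolean algebra `B`: a contact relation together with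
a (possibly non-proper) ideal of bounded elements satisfying (BC1)-(BC3). -/
structure LocalContact (B : Type u) [BooleanAlgebra B] where
  /-- the contact relation -/
  rel : B → B → Prop
  isContact : IsContact rel
  /-- the ideal of bounded elements -/
  bounded : Order.Ideal B
  /-- (BC1) -/
  interpolate : ∀ a ∈ bounded, ∀ c, NonTangential rel a c →
    ∃ b ∈ bounded, NonTangential rel a b ∧ NonTangential rel b c
  /-- (BC2) -/
  local_rel : ∀ a b, rel a b → ∃ c ∈ bounded, rel a (c ⊓ b)
  /-- (BC3) -/
  exists_bounded : ∀ a, a ≠ ⊥ → ∃ b ∈ bounded, b ≠ ⊥ ∧ NonTangential rel b a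

namespace LocalContact

variable {B : Type u} [BooleanAlgebra B] (L : LocalContact B)

/-- The non-tangential inclusion of a local contact algebra. -/
def ll (a b : B) : Prop := NonTangential L.rel a b

variable {L}

theorem rel_mono_right {a b c : B} (h : L.rel a b) (hbc : b ≤ c) : L.rel a c := by
  have := (L.isContact.sup_iff a b c).2 (Or.inl h)
  rwa [sup_eq_right.2 hbc] at this

theorem rel_mono {a b c d : B} (h : L.rel a b) (hac : a ≤ c) (hbd : b ≤ d) : L.rel c d :=
  rel_mono_right (L.isContact.symm _ _ (rel_mono_right (L.isContact.symm _ _ h) hac)) hbd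

theorem ll_mono {a b c d : B} (h : L.ll b c) (hab : a ≤ b) (hcd : c ≤ d) : L.ll a d :=
  fun h' => h (rel_mono h' hab (compl_le_compl hcd))

theorem ll_le {a b : B} (h : L.ll a b) : a ≤ b := by
  by_contra hn
  have h0 : a ⊓ bᶜ ≠ ⊥ := fun h0 => hn (disjoint_compl_right_iff.1 (disjoint_iff.2 h0))
  exact h (rel_mono (L.isContact.refl _ h0) inf_le_left inf_le_right)

theorem bot_ll (a : B) : L.ll ⊥ a := fun h => (L.isContact.ne_bot _ _ h).1 rfl

theorem ll_top (a : B) : L.ll a ⊤ := fun h => (L.isContact.ne_bot _ _ h).2 compl_top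

theorem ll_sup_left {a b c : B} (ha : L.ll a c) (hb : L.ll b c) : L.ll (a ⊔ b) c := by
  intro h
  rcases (L.isContact.sup_iff _ _ _).1 (L.isContact.symm _ _ h) with h | h
  · exact ha (L.isContact.symm _ _ h)
  · exact hb (L.isContact.symm _ _ h)

theorem ll_sup {a b c d : B} (h : L.ll a b) (h' : L.ll c d) : L.ll (a ⊔ c) (b ⊔ d) :=
  ll_sup_left (ll_mono h le_rfl le_sup_left) (ll_mono h' le_rfl le_sup_right)

theorem ll_inf {a b c : B} (h : L.ll a b) (h' : L.ll a c) : L.ll a (b ⊓ c) := by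
  intro hn
  unfold ll NonTangential at h h'
  rw [compl_inf] at hn
  exact ((L.isContact.sup_iff _ _ _).1 hn).elim h h'

end LocalContact

/-- A `δ`-ideal: an ideal `I` of bounded elements such that every `a ∈ I` satisfies `a ≪ b` for
some `b ∈ I`. -/
structure DeltaIdeal {B : Type u} [BooleanAlgebra B] (L : LocalContact B) extends
    Order.Ideal B where
  bounded' : ∀ a ∈ toIdeal, a ∈ L.bounded
  rounded' : ∀ a ∈ toIdeal, ∃ b ∈ toIdeal, L.ll a b

namespace DeltaIdeal

variable {B : Type u} [BooleanAlgebra B] {L : LocalContact B}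

theorem toIdeal_injective :
    Function.Injective (toIdeal : DeltaIdeal L → Order.Ideal B) := by
  rintro ⟨I, _, _⟩ ⟨J, _, _⟩ h
  cases h
  rfl

instance : SetLike (DeltaIdeal L) B where
  coe I := (I.toIdeal : Set B)
  coe_injective _ _ h := toIdeal_injective (SetLike.coe_injective h)

/-- `δ`-ideals are ordered by inclusion. -/
instance : PartialOrder (DeltaIdeal L) := .ofSetLike (DeltaIdeal L) B

@[simp] theorem mem_toIdeal {I : DeltaIdeal L} {a : B} : a ∈ I.toIdeal ↔ a ∈ I := Iff.rfl

@[ext] theorem ext {I J : DeltaIdeal L} (h : ∀ a, a ∈ I ↔ a ∈ J) : I = J := SetLike.ext h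

theorem le_def {I J : DeltaIdeal L} : I ≤ J ↔ ∀ a ∈ I, a ∈ J := Iff.rfl

theorem mem_bounded {I : DeltaIdeal L} {a : B} (h : a ∈ I) : a ∈ L.bounded := I.bounded' a h

theorem exists_ll {I : DeltaIdeal L} {a : B} (h : a ∈ I) : ∃ b ∈ I, L.ll a b := I.rounded' a h

theorem mem_of_le {I : DeltaIdeal L} {a b : B} (h : b ∈ I) (hab : a ≤ b) : a ∈ I :=
  I.toIdeal.lower hab h

theorem bot_mem (I : DeltaIdeal L) : ⊥ ∈ I := I.toIdeal.bot_mem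

theorem sup_mem {I : DeltaIdeal L} {a b : B} (ha : a ∈ I) (hb : b ∈ I) : a ⊔ b ∈ I :=
  Order.Ideal.sup_mem (s := I.toIdeal) ha hb

/-- Build a `δ`-ideal from a set. -/
def ofSet (s : Set B) (h0 : ⊥ ∈ s) (hl : ∀ a b, a ≤ b → b ∈ s → a ∈ s)
    (hs : ∀ a ∈ s, ∀ b ∈ s, a ⊔ b ∈ s) (hb : ∀ a ∈ s, a ∈ L.bounded)
    (hr : ∀ a ∈ s, ∃ b ∈ s, L.ll a b) : DeltaIdeal L where
  carrier := s
  lower' := fun b a hab h => hl a b hab h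
  nonempty' := ⟨⊥, h0⟩
  directed' := fun a ha b hb => ⟨a ⊔ b, hs a ha b hb, le_sup_left, le_sup_right⟩
  bounded' := hb
  rounded' := hr

/-- The intersection of two `δ`-ideals. -/
def inter (I J : DeltaIdeal L) : DeltaIdeal L :=
  ofSet {a | a ∈ I ∧ a ∈ J} ⟨I.bot_mem, J.bot_mem⟩
    (fun _ _ hab h => ⟨mem_of_le h.1 hab, mem_of_le h.2 hab⟩)
    (fun _ ha _ hb => ⟨sup_mem ha.1 hb.1, sup_mem ha.2 hb.2⟩)
    (fun _ h => mem_bounded h.1)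
    (fun a h => by
      obtain ⟨b, hb, hab⟩ := exists_ll h.1
      obtain ⟨c, hc, hac⟩ := exists_ll h.2
      exact ⟨b ⊓ c, ⟨mem_of_le hb inf_le_left, mem_of_le hc inf_le_right⟩,
        LocalContact.ll_inf hab hac⟩)

/-- The join of a family of `δ`-ideals: the finite joins of their elements. -/
def join (S : Set (DeltaIdeal L)) : DeltaIdeal L :=
  ofSet {a | ∃ t : Finset B, (∀ x ∈ t, ∃ I ∈ S, x ∈ I) ∧ a = t.sup id}
    ⟨∅, by simp, by simp⟩
    (by
      classical
      rintro a _ hab ⟨t, ht, rfl⟩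
      refine ⟨t.image (a ⊓ ·), ?_, ?_⟩
      · intro x hx
        obtain ⟨y, hy, rfl⟩ := Finset.mem_image.1 hx
        obtain ⟨I, hI, hyI⟩ := ht y hy
        exact ⟨I, hI, mem_of_le hyI inf_le_right⟩
      · rw [Finset.sup_image, Function.id_comp]
        conv_lhs => rw [← inf_eq_left.2 hab, Finset.sup_inf_distrib_left]
        rfl)
    (by
      classical
      rintro _ ⟨t, ht, rfl⟩ _ ⟨t', ht', rfl⟩
      refine ⟨t ∪ t', ?_, (Finset.sup_union).symm⟩
      intro x hx
      exact (Finset.mem_union.1 hx).elim (ht x) (ht' x))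
    (by
      rintro _ ⟨t, ht, rfl⟩
      refine Finset.sup_induction (p := (· ∈ L.bounded)) (Order.Ideal.bot_mem _)
        (fun a ha b hb => Order.Ideal.sup_mem ha hb) ?_
      intro x hx
      obtain ⟨I, _, hxI⟩ := ht x hx
      exact mem_bounded hxI)
    (by
      classical
      rintro _ ⟨t, ht, rfl⟩
      have key : ∀ x : B, ∃ y : B, x ∈ t → (∃ I ∈ S, y ∈ I) ∧ L.ll x y := by
        intro x
        by_cases hx : x ∈ t
        · obtain ⟨I, hI, hxI⟩ := ht x hx
          obtain ⟨y, hy, hxy⟩ := exists_ll hxI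
          exact ⟨y, fun _ => ⟨⟨I, hI, hy⟩, hxy⟩⟩
        · exact ⟨x, fun h => absurd h hx⟩
      choose g hg using key
      refine ⟨(t.image g).sup id, ⟨t.image g, ?_, rfl⟩, ?_⟩
      · intro y hy
        obtain ⟨x, hx, rfl⟩ := Finset.mem_image.1 hy
        exact (hg x hx).1
      · refine Finset.sup_induction (p := fun a => L.ll a ((t.image g).sup id))
          (LocalContact.bot_ll _) (fun a ha b hb => LocalContact.ll_sup_left ha hb) ?_
        intro x hx
        exact LocalContact.ll_mono (hg x hx).2 le_rfl
          (Finset.le_sup (f := id) (Finset.mem_image_of_mem g hx)))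

theorem isLUB_join (S : Set (DeltaIdeal L)) : IsLUB S (join S) := by
  constructor
  · intro I hI a ha
    refine ⟨{a}, ?_, by simp⟩
    intro x hx
    rw [Finset.mem_singleton.1 hx]
    exact ⟨I, hI, ha⟩
  · intro J hJ a ha
    obtain ⟨t, ht, rfl⟩ := ha
    refine Finset.sup_induction (p := (· ∈ J)) J.bot_mem (fun a ha b hb => sup_mem ha hb) ?_
    intro x hx
    obtain ⟨I, hI, hxI⟩ := ht x hx
    exact hJ hI hxI

/-- The complete lattice of `δ`-ideals, ordered by inclusion: binary meets are intersections, and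
joins consist of the finite joins of elements. -/
instance : CompleteLattice (DeltaIdeal L) :=
  letI : SupSet (DeltaIdeal L) := ⟨join⟩
  { completeLatticeOfSup (DeltaIdeal L) isLUB_join with
    inf := inter
    inf_le_left := fun _ _ _ h => h.1
    inf_le_right := fun _ _ _ h => h.2
    le_inf := fun _ _ _ h h' _ ha => ⟨h ha, h' ha⟩ }

theorem mem_inf {I J : DeltaIdeal L} {a : B} : a ∈ I ⊓ J ↔ a ∈ I ∧ a ∈ J := Iff.rfl

theorem mem_sup {I J : DeltaIdeal L} {a b : B} (ha : a ∈ I) (hb : b ∈ J) : a ⊔ b ∈ I ⊔ J :=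
  sup_mem ((le_sup_left : I ≤ I ⊔ J) ha) ((le_sup_right : J ≤ I ⊔ J) hb)

theorem exists_of_mem_sup {I J : DeltaIdeal L} {c : B} (h : c ∈ I ⊔ J) :
    ∃ a ∈ I, ∃ b ∈ J, c = a ⊔ b := by
  have hle : I ⊔ J ≤ ofSet (L := L) {c | ∃ a ∈ I, ∃ b ∈ J, c = a ⊔ b}
      ⟨⊥, I.bot_mem, ⊥, J.bot_mem, by simp⟩
      (by
        rintro c _ hc ⟨a, ha, b, hb, rfl⟩
        refine ⟨c ⊓ a, mem_of_le ha inf_le_right, c ⊓ b, mem_of_le hb inf_le_right, ?_⟩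
        rw [← inf_sup_left, inf_eq_left.2 hc])
      (by
        rintro _ ⟨a, ha, b, hb, rfl⟩ _ ⟨a', ha', b', hb', rfl⟩
        exact ⟨a ⊔ a', sup_mem ha ha', b ⊔ b', sup_mem hb hb', sup_sup_sup_comm _ _ _ _⟩)
      (by
        rintro _ ⟨a, ha, b, hb, rfl⟩
        exact Order.Ideal.sup_mem (mem_bounded ha) (mem_bounded hb))
      (by
        rintro _ ⟨a, ha, b, hb, rfl⟩
        obtain ⟨a', ha', h⟩ := exists_ll ha
        obtain ⟨b', hb', h'⟩ := exists_ll hb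
        exact ⟨a' ⊔ b', ⟨a', ha', b', hb', rfl⟩, LocalContact.ll_sup h h'⟩) :=
    sup_le (fun a ha => ⟨a, ha, ⊥, J.bot_mem, by simp⟩)
      (fun b hb => ⟨⊥, I.bot_mem, b, hb, by simp⟩)
  exact hle h

/-- A join of a monotone map over an ideal-like set is a union. -/
theorem mem_biSup {A : Type u} [BooleanAlgebra A] (s : Set A) (h0 : ⊥ ∈ s)
    (hs : ∀ a ∈ s, ∀ b ∈ s, a ⊔ b ∈ s) (f : A → DeltaIdeal L) (hf : Monotone f) {x : B} :
    x ∈ (⨆ a ∈ s, f a) ↔ ∃ a ∈ s, x ∈ f a := by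
  constructor
  · intro hx
    have hle : (⨆ a ∈ s, f a) ≤ ofSet (L := L) {x | ∃ a ∈ s, x ∈ f a}
        ⟨⊥, h0, bot_mem _⟩
        (fun x y hxy ⟨a, ha, h⟩ => ⟨a, ha, mem_of_le h hxy⟩)
        (fun x ⟨a, ha, h⟩ y ⟨b, hb, h'⟩ => ⟨a ⊔ b, hs a ha b hb,
          sup_mem (hf le_sup_left h) (hf le_sup_right h')⟩)
        (fun x ⟨a, ha, h⟩ => mem_bounded h)
        (fun x ⟨a, ha, h⟩ => by
          obtain ⟨y, hy, hxy⟩ := exists_ll h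
          exact ⟨y, ⟨a, ha, hy⟩, hxy⟩) :=
      iSup₂_le fun a ha x hx => ⟨a, ha, hx⟩
    exact hle hx
  · rintro ⟨a, ha, hx⟩
    exact (le_iSup₂ (f := fun a (_ : a ∈ s) => f a) a ha) hx

/-- The principal `δ`-ideal `I_a`, consisting of the bounded `b` with `b ≪ a`. -/
def principal (L : LocalContact B) (a : B) : DeltaIdeal L :=
  ofSet {b | b ∈ L.bounded ∧ L.ll b a} ⟨Order.Ideal.bot_mem _, LocalContact.bot_ll _⟩
    (fun _ _ hxy h => ⟨L.bounded.lower hxy h.1, LocalContact.ll_mono h.2 hxy le_rfl⟩)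
    (fun _ hx _ hy => ⟨Order.Ideal.sup_mem hx.1 hy.1, LocalContact.ll_sup_left hx.2 hy.2⟩)
    (fun _ h => h.1)
    (fun x h => by
      obtain ⟨b, hb, h1, h2⟩ := L.interpolate x h.1 a h.2
      exact ⟨b, ⟨hb, h2⟩, h1⟩)

theorem mem_principal {a b : B} : b ∈ principal L a ↔ b ∈ L.bounded ∧ L.ll b a := Iff.rfl

theorem principal_mono : Monotone (principal L) :=
  fun _ _ h _ hx => ⟨hx.1, LocalContact.ll_mono hx.2 le_rfl h⟩

end DeltaIdeal

/-- The objects of the category: complete local contact algebras. -/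
structure MDHLC : Type (u + 1) where
  /-- the underlying set -/
  carrier : Type u
  [str : CompleteBooleanAlgebra carrier]
  /-- the contact relation and the ideal of bounded elements -/
  loc : LocalContact carrier

namespace MDHLC

attribute [instance] MDHLC.str

/-- A morphism: a multi-valued map `a ↦ φ(a)` satisfying (M1)-(M6). -/
structure Hom (A B : MDHLC.{u}) where
  /-- the values are `δ`-ideals: this is (M1) -/
  toFun : A.carrier → DeltaIdeal B.loc
  /-- (M2) -/
  map_inf : ∀ a b, toFun (a ⊓ b) = toFun a ⊓ toFun b
  /-- (M3) -/
  map_eq_iSup : ∀ a, toFun a = ⨆ b ∈ {b | b ∈ A.loc.bounded ∧ A.loc.ll b a}, toFun b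
  /-- (M4) -/
  map_bot : (toFun ⊥ : Set B.carrier) = {⊥}
  /-- (M5) -/
  map_sup_le : ∀ a₁ ∈ A.loc.bounded, ∀ a₂ ∈ A.loc.bounded,
    ∀ b₁ ∈ A.loc.bounded, ∀ b₂ ∈ A.loc.bounded, A.loc.ll a₁ b₁ → A.loc.ll a₂ b₂ →
      toFun (a₁ ⊔ a₂) ≤ toFun b₁ ⊔ toFun b₂
  /-- (M6) -/
  exists_mem : ∀ b ∈ B.loc.bounded, ∃ a ∈ A.loc.bounded, b ∈ toFun a

namespace Hom

@[ext] theorem ext {A B : MDHLC.{u}} {φ ψ : Hom A B} (h : ∀ a, φ.toFun a = ψ.toFun a) :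
    φ = ψ := by
  cases φ
  cases ψ
  congr
  exact funext h

theorem mono {A B : MDHLC.{u}} (φ : Hom A B) : Monotone φ.toFun := by
  intro a b h
  rw [← inf_eq_left, ← φ.map_inf, inf_eq_left.2 h]

theorem mem_iff {A B : MDHLC.{u}} (φ : Hom A B) {a : A.carrier} {x : B.carrier} :
    x ∈ φ.toFun a ↔ ∃ b, (b ∈ A.loc.bounded ∧ A.loc.ll b a) ∧ x ∈ φ.toFun b := by
  rw [φ.map_eq_iSup a]
  exact DeltaIdeal.mem_biSup _ (DeltaIdeal.bot_mem (DeltaIdeal.principal A.loc a))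
    (fun _ ha _ hb => DeltaIdeal.sup_mem (I := DeltaIdeal.principal A.loc a) ha hb) _ φ.mono

theorem mem_biSup {A B C : MDHLC.{u}} (φ : Hom A B) (ψ : Hom B C) {a : A.carrier}
    {x : C.carrier} :
    x ∈ (⨆ b ∈ φ.toFun a, ψ.toFun b) ↔ ∃ b ∈ φ.toFun a, x ∈ ψ.toFun b :=
  DeltaIdeal.mem_biSup (φ.toFun a : Set B.carrier) (DeltaIdeal.bot_mem _)
    (fun _ ha _ hb => DeltaIdeal.sup_mem ha hb) _ ψ.mono

/-- The identity morphism `a ↦ I_a`. -/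
def id (A : MDHLC.{u}) : Hom A A where
  toFun := DeltaIdeal.principal A.loc
  map_inf a b := by
    ext x
    constructor
    · rintro ⟨hx, h⟩
      exact ⟨⟨hx, LocalContact.ll_mono h le_rfl inf_le_left⟩,
        ⟨hx, LocalContact.ll_mono h le_rfl inf_le_right⟩⟩
    · rintro ⟨h, h'⟩
      exact ⟨h.1, LocalContact.ll_inf h.2 h'.2⟩
  map_eq_iSup a := by
    apply le_antisymm
    · rintro x ⟨hx, h⟩
      obtain ⟨b, hb, h1, h2⟩ := A.loc.interpolate x hx a h
      exact (le_iSup₂ (f := fun b (_ : b ∈ {b | b ∈ A.loc.bounded ∧ A.loc.ll b a}) =>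
        DeltaIdeal.principal A.loc b) b ⟨hb, h2⟩) ⟨hx, h1⟩
    · exact iSup₂_le fun b hb => DeltaIdeal.principal_mono (LocalContact.ll_le hb.2)
  map_bot := by
    ext x
    constructor
    · rintro ⟨_, h⟩
      exact le_bot_iff.1 (LocalContact.ll_le h)
    · rintro rfl
      exact DeltaIdeal.bot_mem _
  map_sup_le a₁ h₁ a₂ h₂ b₁ _ b₂ _ hab₁ hab₂ := by
    rintro c ⟨hc, hca⟩
    have hc' : c = (c ⊓ a₁) ⊔ (c ⊓ a₂) := by
      rw [← inf_sup_left, inf_eq_left.2 (LocalContact.ll_le hca)]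
    change c ∈ DeltaIdeal.principal A.loc b₁ ⊔ DeltaIdeal.principal A.loc b₂
    rw [hc']
    exact DeltaIdeal.mem_sup
      ⟨A.loc.bounded.lower inf_le_left hc, LocalContact.ll_mono hab₁ inf_le_right le_rfl⟩
      ⟨A.loc.bounded.lower inf_le_left hc, LocalContact.ll_mono hab₂ inf_le_right le_rfl⟩
  exists_mem b hb := by
    obtain ⟨a, ha, h, _⟩ := A.loc.interpolate b hb ⊤ (LocalContact.ll_top b)
    exact ⟨a, ha, hb, h⟩

/-- The composition `(ψ ⋄ φ)(a) = ⋁ {ψ(b) | b ∈ φ(a)}`. -/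
def comp {A B C : MDHLC.{u}} (φ : Hom A B) (ψ : Hom B C) : Hom A C where
  toFun a := ⨆ b ∈ φ.toFun a, ψ.toFun b
  map_inf a b := by
    ext x
    rw [DeltaIdeal.mem_inf, mem_biSup, mem_biSup, mem_biSup]
    constructor
    · rintro ⟨c, hc, hx⟩
      rw [φ.map_inf] at hc
      exact ⟨⟨c, hc.1, hx⟩, ⟨c, hc.2, hx⟩⟩
    · rintro ⟨⟨c, hc, hx⟩, ⟨d, hd, hx'⟩⟩
      refine ⟨c ⊓ d, ?_, ?_⟩
      · rw [φ.map_inf]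
        exact ⟨DeltaIdeal.mem_of_le hc inf_le_left, DeltaIdeal.mem_of_le hd inf_le_right⟩
      · rw [ψ.map_inf]
        exact ⟨hx, hx'⟩
  map_eq_iSup a := by
    apply le_antisymm
    · intro x hx
      obtain ⟨c, hc, hxc⟩ := (mem_biSup φ ψ).1 hx
      obtain ⟨b, hb, hcb⟩ := φ.mem_iff.1 hc
      exact (le_iSup₂ (f := fun b (_ : b ∈ {b | b ∈ A.loc.bounded ∧ A.loc.ll b a}) =>
        ⨆ c ∈ φ.toFun b, ψ.toFun c) b hb) ((mem_biSup φ ψ).2 ⟨c, hcb, hxc⟩)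
    · refine iSup₂_le fun b hb x hx => ?_
      obtain ⟨c, hc, hxc⟩ := (mem_biSup φ ψ).1 hx
      exact (mem_biSup φ ψ).2 ⟨c, φ.mono (LocalContact.ll_le hb.2) hc, hxc⟩
  map_bot := by
    ext x
    rw [SetLike.mem_coe, mem_biSup, ← ψ.map_bot]
    constructor
    · rintro ⟨b, hb, hx⟩
      rw [← SetLike.mem_coe, φ.map_bot] at hb
      rwa [Set.mem_singleton_iff.1 hb] at hx
    · intro hx
      exact ⟨⊥, DeltaIdeal.bot_mem _, hx⟩
  map_sup_le a₁ h₁ a₂ h₂ b₁ k₁ b₂ k₂ hab₁ hab₂ := by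
    intro x hx
    obtain ⟨c, hc, hxc⟩ := (mem_biSup φ ψ).1 hx
    obtain ⟨d, hd, e, he, rfl⟩ := DeltaIdeal.exists_of_mem_sup
      (φ.map_sup_le a₁ h₁ a₂ h₂ b₁ k₁ b₂ k₂ hab₁ hab₂ hc)
    obtain ⟨d', hd', hdd⟩ := DeltaIdeal.exists_ll hd
    obtain ⟨e', he', hee⟩ := DeltaIdeal.exists_ll he
    have hx' := ψ.map_sup_le d (DeltaIdeal.mem_bounded hd) e (DeltaIdeal.mem_bounded he)
      d' (DeltaIdeal.mem_bounded hd') e' (DeltaIdeal.mem_bounded he') hdd hee hxc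
    exact (sup_le_sup
      (le_iSup₂ (f := fun b (_ : b ∈ φ.toFun b₁) => ψ.toFun b) d' hd')
      (le_iSup₂ (f := fun b (_ : b ∈ φ.toFun b₂) => ψ.toFun b) e' he')) hx'
  exists_mem c hc := by
    obtain ⟨b, hb, hcb⟩ := ψ.exists_mem c hc
    obtain ⟨a, ha, hba⟩ := φ.exists_mem b hb
    exact ⟨a, ha, (mem_biSup φ ψ).2 ⟨b, hba, hcb⟩⟩

theorem mem_comp {A B C : MDHLC.{u}} {φ : Hom A B} {ψ : Hom B C} {a : A.carrier}
    {x : C.carrier} : x ∈ (comp φ ψ).toFun a ↔ ∃ b ∈ φ.toFun a, x ∈ ψ.toFun b :=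
  mem_biSup φ ψ

end Hom

instance : Category MDHLC.{u} where
  Hom := Hom
  id := Hom.id
  comp φ ψ := Hom.comp φ ψ
  id_comp {A B} φ := by
    ext a x
    rw [Hom.mem_comp, φ.mem_iff]
    rfl
  comp_id {A B} φ := by
    ext a x
    rw [Hom.mem_comp]
    constructor
    · rintro ⟨b, hb, hx⟩
      exact DeltaIdeal.mem_of_le hb (LocalContact.ll_le hx.2)
    · intro hx
      obtain ⟨b, hb, hxb⟩ := DeltaIdeal.exists_ll hx
      exact ⟨b, hb, DeltaIdeal.mem_bounded hx, hxb⟩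
  assoc {A B C D} φ ψ χ := by
    ext a x
    simp only [Hom.mem_comp]
    constructor
    · rintro ⟨c, ⟨b, hb, hc⟩, hx⟩
      exact ⟨b, hb, c, hc, hx⟩
    · rintro ⟨b, hb, c, hc, hx⟩
      exact ⟨c, ⟨b, hb, hc⟩, hx⟩

end MDHLC

/-- The category of locally compact Hausdorff spaces and continuous maps. -/
abbrev HLC : Type (u + 1) :=
  ObjectProperty.FullSubcategory fun X : TopCat.{u} => T2Space X ∧ LocallyCompactSpace X

/-!
A `δ`-ideal of the regular open algebra of a locally compact Hausdorff space is determined by its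
union, which can be any open set. A morphism from the algebra of `Y` to the algebra of `X` therefore
assigns an open subset of `X` to every regular open subset of `Y`, as the preimage under a
continuous map `X → Y` does. The points of the space dual to a local contact algebra are its rounded
decisive filters, on which morphisms act contravariantly. For the regular open algebra of `X` these
are the filters of regular open neighbourhoods of points of `X`, so that every morphism comes from
exactly one continuous map: the regular open functor is fully faithful. By the prime ideal theorem
a contact algebra has enough rounded decisive filters for it to be, when complete, the regular open
algebra of its dual space: the functor is essentially surjective.
-/

open Set TopologicalSpace

instance instCompleteBooleanAlgebraRegular {α : Type*} [Order.Frame α] :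
    CompleteBooleanAlgebra (Heyting.Regular α) :=
  let L : CompleteLattice (Heyting.Regular α) := Heyting.Regular.gi.liftCompleteLattice
  { (inferInstance : BooleanAlgebra (Heyting.Regular α)) with
    sSup := L.sSup
    sInf := L.sInf
    isLUB_sSup := L.isLUB_sSup
    isGLB_sInf := L.isGLB_sInf }

/-! ### The regular open algebra -/

/-- The complete Boolean algebra of regular open subsets of a topological space, realized as the
regular elements of the frame of open sets. -/
def RegularOpens (X : Type*) [TopologicalSpace X] := Heyting.Regular (Opens X)

namespace RegularOpens

section TopologicalSpace

variable {X : Type*} [TopologicalSpace X] {U V : RegularOpens X}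

instance : CompleteBooleanAlgebra (RegularOpens X) :=
  inferInstanceAs (CompleteBooleanAlgebra (Heyting.Regular (Opens X)))

/-- The open set underlying a regular open set. -/
def toOpens (U : RegularOpens X) : Opens X := Heyting.Regular.val U

instance : SetLike (RegularOpens X) X where
  coe U := U.toOpens
  coe_injective := SetLike.coe_injective.comp Heyting.Regular.coe_injective

instance : IsConcreteLE (RegularOpens X) X where
  coe_subset_coe' := Iff.rfl

theorem isOpen (U : RegularOpens X) : IsOpen (U : Set X) := U.toOpens.isOpen

@[simp] theorem coe_bot : ((⊥ : RegularOpens X) : Set X) = ∅ := rfl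

@[simp] theorem coe_inf (U V : RegularOpens X) : ((U ⊓ V : RegularOpens X) : Set X) = ↑U ∩ ↑V :=
  rfl

theorem nonempty_coe : (U : Set X).Nonempty ↔ U ≠ ⊥ := by
  rw [nonempty_iff_ne_empty, ← coe_bot, Ne, SetLike.coe_set_eq]

theorem coe_compl (U : RegularOpens X) : ((Uᶜ : RegularOpens X) : Set X) = (closure ↑U)ᶜ :=
  Opens.coe_compl_eq_interior_compl.trans interior_compl

theorem interior_closure (U : RegularOpens X) : interior (closure (U : Set X)) = U := by
  rw [← compl_inj_iff, ← closure_compl, ← coe_compl, ← compl_inj_iff, ← coe_compl, compl_compl,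
    compl_compl]

theorem closure_coe_compl (U : RegularOpens X) :
    closure ((Uᶜ : RegularOpens X) : Set X) = (↑U)ᶜ := by
  rw [coe_compl, closure_compl, interior_closure]

theorem closure_coe_sup (U V : RegularOpens X) :
    closure ((U ⊔ V : RegularOpens X) : Set X) = closure ↑U ∪ closure ↑V := by
  rw [← compl_compl (U ⊔ V), closure_coe_compl, compl_sup, coe_inf, compl_inter, coe_compl,
    coe_compl, compl_compl, compl_compl]

/-- The interior of the closure of an open set, the least regular open set containing it. -/
def regularize (O : Opens X) : RegularOpens X := Heyting.Regular.toRegular O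

theorem coe_regularize (O : Opens X) : (regularize O : Set X) = interior (closure O) := by
  change ((Oᶜᶜ : Opens X) : Set X) = _
  rw [Opens.coe_compl_eq_interior_compl, Opens.coe_compl_eq_interior_compl, ← closure_compl,
    compl_compl]

/-- The standard contact relation between regular open sets: their closures meet. -/
def Contact (U V : RegularOpens X) : Prop := (closure (U : Set X) ∩ closure V).Nonempty

theorem isContact_contact : IsContact (Contact (X := X)) where
  refl U hU := by rwa [Contact, inter_self, closure_nonempty_iff, nonempty_coe]
  ne_bot := by
    rintro U V ⟨x, hU, hV⟩
    rw [← nonempty_coe, ← nonempty_coe]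
    exact ⟨closure_nonempty_iff.1 ⟨x, hU⟩, closure_nonempty_iff.1 ⟨x, hV⟩⟩
  symm U V h := by rwa [Contact, inter_comm]
  sup_iff U V W := by simp only [Contact, closure_coe_sup, inter_union_distrib_left, union_nonempty]

theorem nonTangential_contact_iff : NonTangential Contact U V ↔ closure (U : Set X) ⊆ V := by
  rw [NonTangential, Contact, closure_coe_compl, inter_compl_nonempty_iff, not_not]

variable (X) in
/-- The ideal of regular open sets with compact closure. -/
def relativelyCompact : Order.Ideal (RegularOpens X) where
  carrier := {U | IsCompact (closure (U : Set X))}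
  lower' _ _ h hV := hV.of_isClosed_subset isClosed_closure (closure_mono h)
  nonempty' := ⟨⊥, by simp⟩
  directed' U hU V hV := by
    refine ⟨U ⊔ V, ?_, le_sup_left, le_sup_right⟩
    rw [mem_ofPred_eq, closure_coe_sup]
    exact hU.union hV

theorem mem_relativelyCompact : U ∈ relativelyCompact X ↔ IsCompact (closure (U : Set X)) :=
  Iff.rfl

end TopologicalSpace

section LocallyCompact

variable {X : Type*} [TopologicalSpace X] [RegularSpace X] [LocallyCompactSpace X]
  {U V : RegularOpens X}

theorem exists_between {K O : Set X} (hK : IsCompact K) (hO : IsOpen O) (hKO : K ⊆ O) :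
    ∃ W ∈ relativelyCompact X, K ⊆ W ∧ closure (W : Set X) ⊆ O := by
  obtain ⟨V, hV, hKV, hVO, hVc⟩ := exists_open_between_and_isCompact_closure hK hO hKO
  have hcl : closure (regularize ⟨V, hV⟩ : Set X) ⊆ closure V := by
    rw [coe_regularize]
    exact closure_minimal interior_subset isClosed_closure
  refine ⟨regularize ⟨V, hV⟩, hVc.of_isClosed_subset isClosed_closure hcl, ?_, hcl.trans hVO⟩
  rw [coe_regularize]
  exact hKV.trans (interior_maximal subset_closure hV)

theorem exists_mem_closure_subset {x : X} {O : Set X} (hO : IsOpen O) (hx : x ∈ O) :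
    ∃ W ∈ relativelyCompact X, x ∈ W ∧ closure (W : Set X) ⊆ O := by
  simpa using exists_between isCompact_singleton hO (singleton_subset_iff.2 hx)

theorem isTopologicalBasis_range_coe :
    IsTopologicalBasis (range ((↑) : RegularOpens X → Set X)) := by
  refine isTopologicalBasis_of_isOpen_of_nhds (forall_mem_range.2 isOpen) fun x O hx hO => ?_
  obtain ⟨W, -, hxW, hWO⟩ := exists_mem_closure_subset hO hx
  exact ⟨W, mem_range_self W, hxW, subset_closure.trans hWO⟩

variable (X) in
/-- The standard local contact structure on the regular open subsets of a locally compact regular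
space. -/
def localContact : LocalContact (RegularOpens X) where
  rel := Contact
  isContact := isContact_contact
  bounded := relativelyCompact X
  interpolate U hU V h := by
    rw [nonTangential_contact_iff] at h
    simp only [nonTangential_contact_iff]
    exact exists_between hU V.isOpen h
  local_rel := by
    rintro U V ⟨x, hU, hV⟩
    obtain ⟨W, hW, hxW, -⟩ := exists_mem_closure_subset isOpen_univ (mem_univ x)
    exact ⟨W, hW, x, hU, W.isOpen.inter_closure ⟨hxW, hV⟩⟩
  exists_bounded U hU := by
    obtain ⟨x, hx⟩ := nonempty_coe.2 hU
    obtain ⟨W, hW, hxW, hWU⟩ := exists_mem_closure_subset U.isOpen hx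
    exact ⟨W, hW, nonempty_coe.1 ⟨x, hxW⟩, nonTangential_contact_iff.2 hWU⟩

theorem ll_iff : (localContact X).ll U V ↔ closure (U : Set X) ⊆ V := nonTangential_contact_iff

/-- The `δ`-ideal of the relatively compact regular open sets whose closure lies in a given open
set. -/
def idealOf (O : Opens X) : DeltaIdeal (localContact X) :=
  DeltaIdeal.ofSet {U | U ∈ relativelyCompact X ∧ closure (U : Set X) ⊆ O}
    (by simp [mem_relativelyCompact])
    (fun _ _ h hV => ⟨(relativelyCompact X).lower h hV.1, (closure_mono h).trans hV.2⟩)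
    (fun U hU V hV => ⟨Order.Ideal.sup_mem hU.1 hV.1, by
      rw [closure_coe_sup]
      exact union_subset hU.2 hV.2⟩)
    (fun _ hU => hU.1)
    (fun U hU => by
      obtain ⟨W, hW, hUW, hWO⟩ := exists_between hU.1 O.isOpen hU.2
      exact ⟨W, ⟨hW, hWO⟩, ll_iff.2 hUW⟩)

theorem principal_eq_idealOf (U : RegularOpens X) :
    DeltaIdeal.principal (localContact X) U = idealOf U.toOpens :=
  DeltaIdeal.ext fun _ => and_congr_right fun _ => ll_iff

/-- The union of a `δ`-ideal of regular open sets. -/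
def support (I : DeltaIdeal (localContact X)) : Opens X := ⨆ U ∈ I, U.toOpens

theorem mem_support {I : DeltaIdeal (localContact X)} {x : X} :
    x ∈ support I ↔ ∃ U ∈ I, x ∈ U := by
  simp only [support, Opens.mem_iSup, exists_prop]
  rfl

theorem support_idealOf (O : Opens X) : support (idealOf O) = O := by
  ext x
  rw [SetLike.mem_coe, mem_support]
  constructor
  · rintro ⟨U, hU, hx⟩
    exact hU.2 (subset_closure hx)
  · intro hx
    obtain ⟨W, hW, hxW, hWO⟩ := exists_mem_closure_subset O.isOpen hx
    exact ⟨W, ⟨hW, hWO⟩, hxW⟩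

theorem exists_mem_of_subset_support {I : DeltaIdeal (localContact X)} {K : Set X}
    (hK : IsCompact K) (h : K ⊆ support I) : ∃ U ∈ I, K ⊆ U := by
  have : Nonempty I := ⟨⟨⊥, I.bot_mem⟩⟩
  obtain ⟨U, hU⟩ := hK.elim_directed_cover (fun U : I => (U.1 : Set X)) (fun U => U.1.isOpen)
    (fun x hx => by
      obtain ⟨U, hU, hxU⟩ := mem_support.1 (h hx)
      exact mem_iUnion.2 ⟨⟨U, hU⟩, hxU⟩)
    (fun U V => ⟨⟨U.1 ⊔ V.1, DeltaIdeal.sup_mem U.2 V.2⟩, SetLike.coe_subset_coe.2 le_sup_left,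
      SetLike.coe_subset_coe.2 le_sup_right⟩)
  exact ⟨U.1, U.2, hU⟩

theorem idealOf_support (I : DeltaIdeal (localContact X)) : idealOf (support I) = I := by
  ext U
  constructor
  · rintro ⟨hU, h⟩
    obtain ⟨V, hV, hUV⟩ := exists_mem_of_subset_support hU h
    exact DeltaIdeal.mem_of_le hV (SetLike.coe_subset_coe.1 (subset_closure.trans hUV))
  · intro hU
    obtain ⟨V, hV, hUV⟩ := DeltaIdeal.exists_ll hU
    exact ⟨DeltaIdeal.mem_bounded hU, fun x hx => mem_support.2 ⟨V, hV, ll_iff.1 hUV hx⟩⟩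

variable (X) in
/-- The `δ`-ideals of regular open sets are the open sets of the space. -/
def opensOrderIso : Opens X ≃o DeltaIdeal (localContact X) :=
  Equiv.toOrderIso ⟨idealOf, support, support_idealOf, idealOf_support⟩
    (fun _ _ h _ hU => ⟨hU.1, hU.2.trans h⟩) (fun _ _ h => biSup_mono h)

theorem opensOrderIso_apply (O : Opens X) : opensOrderIso X O = idealOf O := rfl

end LocallyCompact

section Comap

variable {X Y : Type u} [TopologicalSpace X] [RegularSpace X] [LocallyCompactSpace X]
  [TopologicalSpace Y] [RegularSpace Y] [LocallyCompactSpace Y]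

variable (X) in
/-- The complete local contact algebra of regular open subsets of a locally compact regular
space. -/
abbrev algebra : MDHLC.{u} where
  carrier := RegularOpens X
  loc := localContact X

theorem idealOf_comap_eq_iSup (f : C(X, Y)) (O : Opens Y) :
    idealOf (Opens.comap f O) = ⨆ W ∈ idealOf O, idealOf (Opens.comap f W.toOpens) :=
  calc idealOf (Opens.comap f O)
      = opensOrderIso X (Opens.comap f (support (idealOf O))) := by
        rw [support_idealOf, opensOrderIso_apply]
    _ = ⨆ W ∈ idealOf O, opensOrderIso X (Opens.comap f W.toOpens) := by
        simp only [support, map_iSup]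

/-- The morphism `V ↦ {U | closure U is compact and contained in f ⁻¹' V}` induced by a continuous
map `f`. -/
def comap (f : C(X, Y)) : MDHLC.Hom (algebra Y) (algebra X) where
  toFun V := idealOf (Opens.comap f (toOpens V))
  map_inf U V := (opensOrderIso X).map_inf (Opens.comap f (toOpens U)) (Opens.comap f (toOpens V))
  map_eq_iSup V := by
    rw [idealOf_comap_eq_iSup, ← principal_eq_idealOf]
    rfl
  map_bot := by
    ext U
    constructor
    · rintro ⟨-, hU⟩
      exact SetLike.coe_injective (subset_empty_iff.1 (subset_closure.trans hU))
    · rintro rfl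
      exact DeltaIdeal.bot_mem _
  map_sup_le U₁ _ U₂ _ V₁ _ V₂ _ h₁ h₂ := by
    have hle : toOpens (U₁ ⊔ U₂ : RegularOpens Y) ≤ toOpens V₁ ⊔ toOpens V₂ := by
      have hcl := (closure_coe_sup U₁ U₂).subset.trans
        (union_subset_union (ll_iff.1 h₁) (ll_iff.1 h₂))
      exact subset_closure.trans hcl
    calc idealOf (Opens.comap f (toOpens (U₁ ⊔ U₂ : RegularOpens Y)))
        ≤ idealOf (Opens.comap f (toOpens V₁ ⊔ toOpens V₂)) :=
          (opensOrderIso X).monotone (OrderHomClass.mono (Opens.comap f) hle)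
      _ = idealOf (Opens.comap f (toOpens V₁)) ⊔ idealOf (Opens.comap f (toOpens V₂)) := by
          rw [map_sup]
          exact (opensOrderIso X).map_sup _ _
  exists_mem U hU := by
    obtain ⟨W, hW, hUW, -⟩ := exists_between (IsCompact.image hU f.continuous) isOpen_univ
      (subset_univ _)
    exact ⟨W, hW, hU, fun x hx => hUW (mem_image_of_mem f hx)⟩

theorem comap_toFun (f : C(X, Y)) (V : RegularOpens Y) :
    (comap f).toFun V = idealOf (Opens.comap f V.toOpens) := rfl

end Comap

end RegularOpens

/-! ### Points of the dual space -/

namespace LocalContact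

variable {B : Type*} [BooleanAlgebra B] {L : LocalContact B}

theorem ll_compl {a b : B} (h : L.ll a b) : L.ll bᶜ aᶜ := by
  intro h'
  rw [compl_compl] at h'
  exact h (L.isContact.symm _ _ h')

/-- The ideal of the elements non-tangentially below `c`. -/
def llIdeal (L : LocalContact B) (c : B) : Order.Ideal B where
  carrier := {b | L.ll b c}
  lower' _ _ hxy hx := ll_mono hx hxy le_rfl
  nonempty' := ⟨⊥, bot_ll c⟩
  directed' x hx y hy := ⟨x ⊔ y, ll_sup_left hx hy, le_sup_left, le_sup_right⟩

/-- A proper filter that has a bounded element and, whenever `a ≪ b` with `a` bounded, contains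
`aᶜ` or `b`. Decisive filters play the part of ultrafilters with a limit: they determine a point of
the dual space, see `ContactEnd.ofDecisive`. -/
structure IsDecisive (L : LocalContact B) (F : Order.PFilter B) : Prop where
  bot_notMem : ⊥ ∉ F
  exists_bounded : ∃ a ∈ F, a ∈ L.bounded
  compl_mem_or_mem : ∀ a ∈ L.bounded, ∀ b, L.ll a b → aᶜ ∈ F ∨ b ∈ F

theorem isDecisive_compl {J : Order.Ideal B} (hJ : J.IsPrime) {a : B} (ha : a ∉ J)
    (hab : a ∈ L.bounded) : L.IsDecisive hJ.compl_filter.toPFilter where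
  bot_notMem h := h J.bot_mem
  exists_bounded := ⟨a, ha, hab⟩
  compl_mem_or_mem r _ s hrs := by
    by_contra! h
    have hr : rᶜ ∈ J := not_not.1 h.1
    have hs : s ∈ J := not_not.1 h.2
    have htop : (⊤ : B) ∈ J := by
      rw [← sup_compl_eq_top (x := r)]
      exact Order.Ideal.sup_mem (J.lower (ll_le hrs) hs) hr
    exact ha (J.lower le_top htop)

end LocalContact

/-- The filter carried by a nonempty upper set that is closed under binary meets. -/
def filterOfInf {P : Type*} [SemilatticeInf P] (s : Set P) (hne : s.Nonempty) (hs : IsUpperSet s)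
    (hinf : InfClosed s) : Order.PFilter P :=
  (Order.IsPFilter.of_def hne
    (fun a ha b hb => ⟨a ⊓ b, hinf ha hb, inf_le_left, inf_le_right⟩)
    fun hab ha => hs hab ha).toPFilter

/-- A point of the dual space of a local contact algebra: a decisive filter that is rounded. -/
structure ContactEnd {B : Type*} [BooleanAlgebra B] (L : LocalContact B) extends
    Order.PFilter B where
  isDecisive : L.IsDecisive toPFilter
  rounded : ∀ a ∈ toPFilter, ∃ b ∈ toPFilter, L.ll b a

namespace ContactEnd

open LocalContact

variable {B : Type*} [BooleanAlgebra B] {L : LocalContact B} {x y : ContactEnd L} {a b : B}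

instance : SetLike (ContactEnd L) B where
  coe x := (x.toPFilter : Set B)
  coe_injective := by
    rintro ⟨F, _, _⟩ ⟨G, _, _⟩ h
    cases SetLike.coe_injective h
    rfl

theorem mem_of_le (h : a ≤ b) (ha : a ∈ x) : b ∈ x := Order.PFilter.mem_of_le h ha

theorem inf_mem_iff : a ⊓ b ∈ x ↔ a ∈ x ∧ b ∈ x := Order.PFilter.inf_mem_iff

theorem top_mem (x : ContactEnd L) : ⊤ ∈ x := Order.PFilter.top_mem

theorem bot_notMem (x : ContactEnd L) : ⊥ ∉ x := x.isDecisive.bot_notMem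

theorem notMem_of_disjoint (h : Disjoint a b) (ha : a ∈ x) : b ∉ x :=
  fun hb => x.bot_notMem (h.eq_bot ▸ inf_mem_iff.2 ⟨ha, hb⟩)

theorem exists_bounded (x : ContactEnd L) : ∃ a ∈ x, a ∈ L.bounded := x.isDecisive.exists_bounded

theorem exists_bounded_ll (ha : a ∈ x) : ∃ b ∈ x, b ∈ L.bounded ∧ L.ll b a := by
  obtain ⟨b, hb, hba⟩ := x.rounded a ha
  obtain ⟨d, hd, hdb⟩ := x.exists_bounded
  exact ⟨b ⊓ d, inf_mem_iff.2 ⟨hb, hd⟩, L.bounded.lower inf_le_right hdb,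
    ll_mono hba inf_le_left le_rfl⟩

theorem compl_mem_or_mem (x : ContactEnd L) (h : L.ll a b) : aᶜ ∈ x ∨ b ∈ x := by
  obtain ⟨d, hd, hdb⟩ := x.exists_bounded
  refine (x.isDecisive.compl_mem_or_mem (a ⊓ d) (L.bounded.lower inf_le_right hdb) b
    (ll_mono h inf_le_left le_rfl)).imp_left fun h' => ?_
  have hmeet : (a ⊓ d)ᶜ ⊓ d ≤ aᶜ := by
    rw [compl_inf, inf_sup_right, compl_inf_self, sup_bot_eq]
    exact inf_le_left
  exact mem_of_le hmeet (inf_mem_iff.2 ⟨h', hd⟩)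

theorem eq_of_subset (h : (x : Set B) ⊆ y) : x = y := by
  refine SetLike.coe_injective (h.antisymm fun b hb => ?_)
  obtain ⟨c, hc, hcb⟩ := y.rounded b hb
  exact (x.compl_mem_or_mem hcb).resolve_left fun h' =>
    notMem_of_disjoint disjoint_compl_right hc (h h')

theorem exists_mem_or_exists_mem_of_mem_sup {I J : DeltaIdeal L} {e : B} (he : e ∈ I ⊔ J)
    (hx : e ∈ x) : (∃ a ∈ I, a ∈ x) ∨ ∃ b ∈ J, b ∈ x := by
  obtain ⟨a, ha, b, hb, rfl⟩ := DeltaIdeal.exists_of_mem_sup he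
  obtain ⟨a', ha', haa'⟩ := DeltaIdeal.exists_ll ha
  obtain ⟨b', hb', hbb'⟩ := DeltaIdeal.exists_ll hb
  rcases x.compl_mem_or_mem haa' with hax | hax
  · rcases x.compl_mem_or_mem hbb' with hbx | hbx
    · have hcompl : (a ⊔ b)ᶜ ∈ x := by
        rw [compl_sup]
        exact inf_mem_iff.2 ⟨hax, hbx⟩
      exact absurd hcompl (notMem_of_disjoint disjoint_compl_right hx)
    · exact Or.inr ⟨b', hb', hbx⟩
  · exact Or.inl ⟨a', ha', hax⟩

/-- The rounding of a decisive filter. -/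
def ofDecisive {F : Order.PFilter B} (hF : L.IsDecisive F) : ContactEnd L where
  toPFilter := filterOfInf {b | ∃ c ∈ F, c ∈ L.bounded ∧ L.ll c b}
    (by
      obtain ⟨c, hc, hcb⟩ := hF.exists_bounded
      exact ⟨⊤, c, hc, hcb, ll_top c⟩)
    (fun _ _ hab ⟨c, hc, hcb, hca⟩ => ⟨c, hc, hcb, ll_mono hca le_rfl hab⟩)
    (fun _ ⟨c, hc, hcb, hca⟩ _ ⟨d, hd, _, hdb⟩ =>
      ⟨c ⊓ d, Order.PFilter.inf_mem hc hd, L.bounded.lower inf_le_left hcb,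
        ll_inf (ll_mono hca inf_le_left le_rfl) (ll_mono hdb inf_le_right le_rfl)⟩)
  isDecisive :=
    { bot_notMem := fun ⟨c, hc, _, h⟩ => hF.bot_notMem (le_bot_iff.1 (ll_le h) ▸ hc)
      exists_bounded := by
        obtain ⟨a, ha, hab⟩ := hF.exists_bounded
        obtain ⟨b, hb, h, -⟩ := L.interpolate a hab ⊤ (ll_top a)
        exact ⟨b, ⟨a, ha, hab, h⟩, hb⟩
      compl_mem_or_mem := by
        intro r hr s hrs
        obtain ⟨t, ht, hrt, hts⟩ := L.interpolate r hr s hrs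
        obtain ⟨q, hq, hrq, hqt⟩ := L.interpolate r hr t hrt
        obtain ⟨d, hd, hdb⟩ := hF.exists_bounded
        refine (hF.compl_mem_or_mem q hq t hqt).imp (fun h => ?_) fun h => ⟨t, h, ht, hts⟩
        exact ⟨qᶜ ⊓ d, Order.PFilter.inf_mem h hd, L.bounded.lower inf_le_right hdb,
          ll_mono (ll_compl hrq) inf_le_left le_rfl⟩ }
  rounded := by
    rintro a ⟨c, hc, hcb, hca⟩
    obtain ⟨b, _, hcb', hba⟩ := L.interpolate c hcb a hca
    exact ⟨b, ⟨c, hc, hcb, hcb'⟩, hba⟩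

theorem mem_of_mem_ofDecisive {F : Order.PFilter B} {hF : L.IsDecisive F}
    (hb : b ∈ ofDecisive hF) : b ∈ F :=
  let ⟨_, hc, _, hcb⟩ := hb
  Order.PFilter.mem_of_le (ll_le hcb) hc

theorem exists_of_rel {a c : B} (ha : a ∈ L.bounded) (h : L.rel a c) :
    ∃ x : ContactEnd L, aᶜ ∉ x ∧ cᶜ ∉ x := by
  have hdisj : Disjoint (Order.PFilter.principal a : Set B) (L.llIdeal cᶜ) := by
    rw [Set.disjoint_left]
    intro b hab hbc
    have hac : L.ll a cᶜ := ll_mono hbc hab le_rfl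
    exact hac (by rwa [compl_compl])
  obtain ⟨J, hJ, hcJ, hJa⟩ := DistribLattice.prime_ideal_of_disjoint_filter_ideal hdisj
  have haJ : a ∉ J := Set.disjoint_left.1 hJa (le_refl a : a ≤ a)
  refine ⟨ofDecisive (isDecisive_compl hJ haJ ha), fun h => ?_, ?_⟩
  · have haJ' : aᶜ ∉ J := mem_of_mem_ofDecisive h
    exact hJ.mem_or_compl_mem.elim haJ haJ'
  · rintro ⟨d, hd, -, hdc⟩
    exact hd (hcJ hdc)

theorem exists_mem (ha : a ≠ ⊥) : ∃ x : ContactEnd L, a ∈ x := by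
  obtain ⟨b, hb, hb0, hba⟩ := L.exists_bounded a ha
  obtain ⟨x, hx, -⟩ := exists_of_rel hb (L.isContact.refl b hb0)
  exact ⟨x, (x.compl_mem_or_mem hba).resolve_left hx⟩

end ContactEnd

namespace MDHLC.Hom

open LocalContact

variable {A B : MDHLC.{u}} (φ : Hom A B) (x : ContactEnd B.loc)

/-- The filter underlying `comapEnd`. -/
def comapFilter : Order.PFilter A.carrier :=
  filterOfInf {a | ∃ b ∈ φ.toFun a, b ∈ x}
    (by
      obtain ⟨b, hbx, hb⟩ := x.exists_bounded
      obtain ⟨a, -, hba⟩ := φ.exists_mem b hb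
      exact ⟨a, b, hba, hbx⟩)
    (fun _ _ haa' ⟨b, hb, hbx⟩ => ⟨b, φ.mono haa' hb, hbx⟩)
    (fun a ⟨b, hb, hbx⟩ a' ⟨b', hb', hbx'⟩ => by
      refine ⟨b ⊓ b', ?_, ContactEnd.inf_mem_iff.2 ⟨hbx, hbx'⟩⟩
      rw [φ.map_inf]
      exact ⟨DeltaIdeal.mem_of_le hb inf_le_left, DeltaIdeal.mem_of_le hb' inf_le_right⟩)

variable {φ x}

theorem mem_comapFilter {a : A.carrier} : a ∈ φ.comapFilter x ↔ ∃ b ∈ φ.toFun a, b ∈ x := Iff.rfl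

theorem mem_or_mem_comapFilter_of_sup {a₁ a₂ b₁ b₂ : A.carrier} (ha₁ : a₁ ∈ A.loc.bounded)
    (ha₂ : a₂ ∈ A.loc.bounded) (hb₁ : b₁ ∈ A.loc.bounded) (hb₂ : b₂ ∈ A.loc.bounded)
    (h₁ : A.loc.ll a₁ b₁) (h₂ : A.loc.ll a₂ b₂) (h : a₁ ⊔ a₂ ∈ φ.comapFilter x) :
    b₁ ∈ φ.comapFilter x ∨ b₂ ∈ φ.comapFilter x := by
  obtain ⟨c, hc, hcx⟩ := h
  exact ContactEnd.exists_mem_or_exists_mem_of_mem_sup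
    (φ.map_sup_le a₁ ha₁ a₂ ha₂ b₁ hb₁ b₂ hb₂ h₁ h₂ hc) hcx

variable (φ x)

theorem isDecisive_comapFilter : A.loc.IsDecisive (φ.comapFilter x) where
  bot_notMem := by
    rintro ⟨b, hb, hbx⟩
    have hb' : b = ⊥ := φ.map_bot.subset hb
    exact x.bot_notMem (hb' ▸ hbx)
  exists_bounded := by
    obtain ⟨b, hbx, hb⟩ := x.exists_bounded
    obtain ⟨a, ha, hba⟩ := φ.exists_mem b hb
    exact ⟨a, ⟨b, hba, hbx⟩, ha⟩
  compl_mem_or_mem a ha b hab := by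
    obtain ⟨a₁, ha₁, haa₁, ha₁b⟩ := A.loc.interpolate a ha b hab
    obtain ⟨a₂, ha₂, ha₁₂, ha₂b⟩ := A.loc.interpolate a₁ ha₁ b ha₁b
    obtain ⟨c, hcx, hcφ⟩ := x.exists_bounded
    obtain ⟨d, hd, hcd⟩ := φ.exists_mem c hcφ
    obtain ⟨d', hd', hdd', -⟩ := A.loc.interpolate d hd ⊤ (ll_top d)
    have hcover : a₁ ⊔ d ⊓ a₁ᶜ ∈ φ.comapFilter x := by
      refine Order.PFilter.mem_of_le ?_ (mem_comapFilter.2 ⟨c, hcd, hcx⟩)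
      rw [sup_inf_left, sup_compl_eq_top, inf_top_eq]
      exact le_sup_right
    have hll : A.loc.ll (d ⊓ a₁ᶜ) (d' ⊓ aᶜ) :=
      ll_inf (ll_mono hdd' inf_le_left le_rfl) (ll_mono (ll_compl haa₁) inf_le_right le_rfl)
    exact (mem_or_mem_comapFilter_of_sup ha₁ (A.loc.bounded.lower inf_le_left hd) ha₂
      (A.loc.bounded.lower inf_le_left hd') ha₁₂ hll hcover).symm.imp
        (Order.PFilter.mem_of_le inf_le_right) (Order.PFilter.mem_of_le (ll_le ha₂b))

/-- The map of dual spaces induced by a morphism of complete local contact algebras. -/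
def comapEnd : ContactEnd A.loc where
  toPFilter := φ.comapFilter x
  isDecisive := φ.isDecisive_comapFilter x
  rounded := by
    rintro a ⟨c, hc, hcx⟩
    obtain ⟨b, hb, hcb⟩ := φ.mem_iff.1 hc
    exact ⟨b, ⟨c, hcb, hcx⟩, hb.2⟩

end MDHLC.Hom

/-! ### Recovering a space and its maps from the regular open algebras -/

namespace RegularOpens

section NhdsEnd

variable {X : Type*} [TopologicalSpace X] [RegularSpace X] [LocallyCompactSpace X]

/-- The regular open neighbourhoods of a point, as a point of the dual space. -/
def nhdsEnd (x : X) : ContactEnd (localContact X) where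
  toPFilter := filterOfInf {U | x ∈ U}
    (by
      obtain ⟨U, -, hU, -⟩ := exists_mem_closure_subset isOpen_univ (mem_univ x)
      exact ⟨U, hU⟩)
    (fun _ _ hUV hU => hUV hU) (fun _ hU _ hV => ⟨hU, hV⟩)
  isDecisive :=
    { bot_notMem := notMem_empty x
      exists_bounded := by
        obtain ⟨U, hUc, hU, -⟩ := exists_mem_closure_subset isOpen_univ (mem_univ x)
        exact ⟨U, hU, hUc⟩
      compl_mem_or_mem := fun U _ V hUV => by
        by_cases hx : x ∈ closure (U : Set X)
        · exact Or.inr (ll_iff.1 hUV hx)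
        · exact Or.inl ((coe_compl U).superset hx) }
  rounded U hU := by
    obtain ⟨V, -, hV, hVU⟩ := exists_mem_closure_subset U.isOpen hU
    exact ⟨V, hV, ll_iff.2 hVU⟩

theorem mem_nhdsEnd {x : X} {U : RegularOpens X} : U ∈ nhdsEnd x ↔ x ∈ U := Iff.rfl

theorem nhdsEnd_injective [T0Space X] : Function.Injective (nhdsEnd : X → _) := fun x y h =>
  Inseparable.eq <| isTopologicalBasis_range_coe.inseparable_iff.2 <|
    forall_mem_range.2 fun U => by
      rw [SetLike.mem_coe, SetLike.mem_coe, ← mem_nhdsEnd, h, mem_nhdsEnd]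

theorem exists_forall_mem_closure (F : ContactEnd (localContact X)) :
    ∃ y : X, ∀ U ∈ F, y ∈ closure (U : Set X) := by
  obtain ⟨V, hVF, hV⟩ := F.exists_bounded
  let ι := {U : RegularOpens X // U ∈ F ∧ U ≤ V}
  have : Nonempty ι := ⟨⟨V, hVF, le_rfl⟩⟩
  obtain ⟨y, hy⟩ := IsCompact.nonempty_iInter_of_directed_nonempty_isCompact_isClosed
    (fun U : ι => closure (U.1 : Set X))
    (fun U W => ⟨⟨U.1 ⊓ W.1, ContactEnd.inf_mem_iff.2 ⟨U.2.1, W.2.1⟩, inf_le_left.trans U.2.2⟩,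
      closure_mono inter_subset_left, closure_mono inter_subset_right⟩)
    (fun U => closure_nonempty_iff.2 <| nonempty_coe.2 fun h => F.bot_notMem (h ▸ U.2.1))
    (fun U => (relativelyCompact X).lower U.2.2 hV)
    (fun _ => isClosed_closure)
  refine ⟨y, fun U hU => ?_⟩
  have hyUV := mem_iInter.1 hy ⟨U ⊓ V, ContactEnd.inf_mem_iff.2 ⟨hU, hVF⟩, inf_le_right⟩
  exact closure_mono inter_subset_left hyUV

theorem nhdsEnd_surjective : Function.Surjective (nhdsEnd : X → _) := by
  intro F
  obtain ⟨y, hy⟩ := exists_forall_mem_closure F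
  refine ⟨y, (ContactEnd.eq_of_subset fun U hU => ?_).symm⟩
  obtain ⟨V, hV, hVU⟩ := F.rounded U hU
  exact ll_iff.1 hVU (hy V hV)

end NhdsEnd

section Comap

variable {X Y : Type u} [TopologicalSpace X] [RegularSpace X] [LocallyCompactSpace X]
  [TopologicalSpace Y] [RegularSpace Y] [LocallyCompactSpace Y]

theorem mem_comapEnd_nhdsEnd {φ : MDHLC.Hom (algebra Y) (algebra X)} {x : X} {V : RegularOpens Y} :
    V ∈ φ.comapEnd (nhdsEnd x) ↔ x ∈ support (φ.toFun V) :=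
  mem_support.symm

theorem comapEnd_comap (f : C(X, Y)) (x : X) :
    (comap f).comapEnd (nhdsEnd x) = nhdsEnd (f x) := by
  refine SetLike.ext fun V => mem_comapEnd_nhdsEnd.trans ?_
  rw [comap_toFun, support_idealOf]
  rfl

theorem comap_injective [T0Space Y] :
    Function.Injective (comap : C(X, Y) → MDHLC.Hom (algebra Y) (algebra X)) := by
  intro f g h
  ext x
  apply nhdsEnd_injective
  rw [← comapEnd_comap, h, comapEnd_comap]

theorem comap_surjective :
    Function.Surjective (comap : C(X, Y) → MDHLC.Hom (algebra Y) (algebra X)) := by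
  intro φ
  choose f hf using fun x => nhdsEnd_surjective (φ.comapEnd (nhdsEnd x))
  have hpre (V : RegularOpens Y) : f ⁻¹' V = support (φ.toFun V) := by
    ext x
    rw [mem_preimage, SetLike.mem_coe, ← mem_nhdsEnd, hf, mem_comapEnd_nhdsEnd, SetLike.mem_coe]
  have hcont : Continuous f := isTopologicalBasis_range_coe.continuous_iff.2 <|
    forall_mem_range.2 fun V => by
      rw [hpre]
      exact (support _).isOpen
  refine ⟨⟨f, hcont⟩, MDHLC.Hom.ext fun V => ?_⟩
  calc (comap ⟨f, hcont⟩).toFun V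
      = idealOf (support (φ.toFun V)) := congrArg idealOf (Opens.ext (hpre V))
    _ = φ.toFun V := idealOf_support _

end Comap

end RegularOpens

/-! ### The topology of the dual space -/

namespace ContactEnd

open LocalContact

section BooleanAlgebra

variable {B : Type*} [BooleanAlgebra B] {L : LocalContact B} {a b : B}

/-- The basic open set of the points of the dual space that contain `a`. -/
def basic (L : LocalContact B) (a : B) : Set (ContactEnd L) := {x | a ∈ x}

theorem basic_mono (h : a ≤ b) : basic L a ⊆ basic L b := fun _ => mem_of_le h

theorem basic_inf (a b : B) : basic L (a ⊓ b) = basic L a ∩ basic L b :=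
  Set.ext fun _ => inf_mem_iff

theorem basic_bot : basic L ⊥ = ∅ := eq_empty_of_forall_notMem bot_notMem

theorem basic_nonempty_iff : (basic L a).Nonempty ↔ a ≠ ⊥ := by
  refine ⟨?_, exists_mem⟩
  rintro ⟨x, hx⟩ rfl
  exact x.bot_notMem hx

theorem disjoint_basic_iff : Disjoint (basic L a) (basic L b) ↔ Disjoint a b := by
  rw [Set.disjoint_iff_inter_eq_empty, ← basic_inf, ← not_nonempty_iff_eq_empty,
    basic_nonempty_iff, not_not, disjoint_iff]

theorem basic_subset_basic : basic L a ⊆ basic L b ↔ a ≤ b := by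
  refine ⟨fun h => disjoint_compl_right_iff.1 <| (disjoint_basic_iff (L := L)).1 ?_, basic_mono⟩
  exact (disjoint_basic_iff.2 disjoint_compl_right).mono_left h

instance : TopologicalSpace (ContactEnd L) := generateFrom (range (basic L))

theorem isTopologicalBasis : IsTopologicalBasis (range (basic L)) where
  exists_subset_inter := by
    rintro _ ⟨a, rfl⟩ _ ⟨b, rfl⟩ x hx
    exact ⟨_, ⟨a ⊓ b, rfl⟩, inf_mem_iff.2 hx, (basic_inf a b).subset⟩
  sUnion_eq := eq_univ_of_forall fun x => ⟨_, ⟨⊤, rfl⟩, x.top_mem⟩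
  eq_generateFrom := rfl

theorem isOpen_basic (a : B) : IsOpen (basic L a) := isTopologicalBasis.isOpen ⟨a, rfl⟩

theorem exists_basic_subset {x : ContactEnd L} {s : Set (ContactEnd L)} (hs : s ∈ nhds x) :
    ∃ a ∈ x, basic L a ⊆ s := by
  obtain ⟨_, ⟨a, rfl⟩, ha, has⟩ := isTopologicalBasis.mem_nhds_iff.1 hs
  exact ⟨a, ha, has⟩

theorem closure_basic (a : B) : closure (basic L a) = (basic L aᶜ)ᶜ := by
  apply Subset.antisymm
  · exact closure_minimal (disjoint_basic_iff.2 disjoint_compl_right).subset_compl_right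
      (isOpen_basic _).isClosed_compl
  · intro x hx
    rw [mem_closure_iff_nhds]
    intro s hs
    obtain ⟨b, hb, hbs⟩ := exists_basic_subset hs
    have hba : ¬ Disjoint b a := fun h => hx (mem_of_le h.le_compl_right hb)
    rw [← disjoint_basic_iff (L := L), Set.not_disjoint_iff_nonempty_inter] at hba
    exact hba.mono (inter_subset_inter_left _ hbs)

theorem interior_closure_basic (a : B) : interior (closure (basic L a)) = basic L a := by
  rw [closure_basic, interior_compl, closure_basic, compl_compl, compl_compl]

/-- The basic open set of an element, which is regular open, as a `RegularOpens`. -/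
def basicRegular (L : LocalContact B) (a : B) : RegularOpens (ContactEnd L) :=
  RegularOpens.regularize ⟨basic L a, isOpen_basic a⟩

theorem coe_basicRegular (a : B) : (basicRegular L a : Set (ContactEnd L)) = basic L a := by
  rw [basicRegular, RegularOpens.coe_regularize, Opens.coe_mk, interior_closure_basic]

theorem closure_basic_subset (h : L.ll a b) : closure (basic L a) ⊆ basic L b := by
  rw [closure_basic]
  exact fun x hx => (x.compl_mem_or_mem h).resolve_left hx

theorem closure_inter_closure_basic_nonempty_iff :
    (closure (basic L a) ∩ closure (basic L b)).Nonempty ↔ L.rel a b := by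
  constructor
  · rintro ⟨x, hxa, hxb⟩
    by_contra h
    have hll : L.ll a bᶜ := fun h' => h (by rwa [compl_compl] at h')
    rw [closure_basic] at hxb
    exact hxb (closure_basic_subset hll hxa)
  · intro h
    obtain ⟨d, hd, hda⟩ := L.local_rel b a (L.isContact.symm _ _ h)
    obtain ⟨x, hxa, hxb⟩ := exists_of_rel (L.bounded.lower inf_le_left hd)
      (L.isContact.symm _ _ hda)
    rw [closure_basic, closure_basic]
    exact ⟨x, fun hx => hxa (mem_of_le (compl_le_compl inf_le_right) hx), hxb⟩

/-- The elements whose basic open set belongs to an ultrafilter on the dual space. -/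
def traceFilter (F : Ultrafilter (ContactEnd L)) : Order.PFilter B :=
  filterOfInf {b | basic L b ∈ F}
    ⟨⊤, Filter.mem_of_superset Filter.univ_mem fun x _ => x.top_mem⟩
    (fun _ _ hab ha => Filter.mem_of_superset ha (basic_mono hab))
    (fun _ ha _ hb => by
      rw [mem_ofPred_eq, basic_inf]
      exact Filter.inter_mem ha hb)

theorem isDecisive_traceFilter {F : Ultrafilter (ContactEnd L)} (ha : a ∈ L.bounded)
    (hF : closure (basic L a) ∈ F) : L.IsDecisive (traceFilter F) where
  bot_notMem h := F.empty_notMem (basic_bot (L := L) ▸ h)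
  exists_bounded := by
    obtain ⟨d, hd, had, -⟩ := L.interpolate a ha ⊤ (ll_top a)
    exact ⟨d, Filter.mem_of_superset hF (closure_basic_subset had), hd⟩
  compl_mem_or_mem r _ s hrs := by
    rcases F.mem_or_compl_mem (closure (basic L r)) with h | h
    · exact Or.inr (Filter.mem_of_superset h (closure_basic_subset hrs))
    · rw [closure_basic, compl_compl] at h
      exact Or.inl h

theorem isCompact_closure_basic (ha : a ∈ L.bounded) : IsCompact (closure (basic L a)) := by
  rw [isCompact_iff_ultrafilter_le_nhds']
  intro F hF
  let x := ofDecisive (isDecisive_traceFilter ha hF)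
  have hle : (F : Filter (ContactEnd L)) ≤ nhds x := by
    intro s hs
    obtain ⟨b, hb, hbs⟩ := exists_basic_subset hs
    exact Filter.mem_of_superset (mem_of_mem_ofDecisive hb : basic L b ∈ F) hbs
  exact ⟨x, isClosed_closure.mem_of_frequently_of_tendsto (f := id)
    (Filter.Eventually.frequently hF) hle, hle⟩

theorem mem_bounded_of_isCompact (h : IsCompact (closure (basic L a))) : a ∈ L.bounded := by
  have : Nonempty L.bounded := ⟨⟨⊥, Order.Ideal.bot_mem _⟩⟩
  obtain ⟨b, hb⟩ := h.elim_directed_cover (fun b : L.bounded => basic L b.1)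
    (fun b => isOpen_basic _)
    (fun x _ => by
      obtain ⟨b, hb, hbb⟩ := x.exists_bounded
      exact mem_iUnion.2 ⟨⟨b, hbb⟩, hb⟩)
    (fun b c => ⟨⟨b.1 ⊔ c.1, Order.Ideal.sup_mem b.2 c.2⟩, basic_mono le_sup_left,
      basic_mono le_sup_right⟩)
  exact L.bounded.lower (basic_subset_basic.1 (subset_closure.trans hb)) b.2

theorem isCompact_closure_basic_iff : IsCompact (closure (basic L a)) ↔ a ∈ L.bounded :=
  ⟨mem_bounded_of_isCompact, isCompact_closure_basic⟩

instance : T2Space (ContactEnd L) where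
  t2 x y hxy := by
    obtain ⟨b, hbx, hby⟩ := not_subset.1 (mt eq_of_subset hxy)
    obtain ⟨c, hc, hcb⟩ := x.rounded b hbx
    exact ⟨basic L c, basic L cᶜ, isOpen_basic c, isOpen_basic cᶜ, hc,
      (y.compl_mem_or_mem hcb).resolve_right hby, disjoint_basic_iff.2 disjoint_compl_right⟩

instance : LocallyCompactSpace (ContactEnd L) where
  local_compact_nhds x s hs := by
    obtain ⟨a, ha, has⟩ := exists_basic_subset hs
    obtain ⟨b, hb, hbb, hba⟩ := exists_bounded_ll ha
    exact ⟨closure (basic L b),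
      Filter.mem_of_superset ((isOpen_basic b).mem_nhds hb) subset_closure,
      (closure_basic_subset hba).trans has, isCompact_closure_basic hbb⟩

end BooleanAlgebra

end ContactEnd

/-! ### Isomorphisms of contact algebras -/

/-- An isomorphism of local contact algebras. -/
structure ContactIso {A B : Type*} [BooleanAlgebra A] [BooleanAlgebra B] (L : LocalContact A)
    (M : LocalContact B) where
  toOrderIso : A ≃o B
  rel_iff : ∀ a b, M.rel (toOrderIso a) (toOrderIso b) ↔ L.rel a b
  mem_bounded_iff : ∀ a, toOrderIso a ∈ M.bounded ↔ a ∈ L.bounded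

namespace ContactIso

section BooleanAlgebra

variable {A B : Type*} [BooleanAlgebra A] [BooleanAlgebra B] {L : LocalContact A}
  {M : LocalContact B}

/-- The inverse of an isomorphism of local contact algebras. -/
def symm (e : ContactIso L M) : ContactIso M L where
  toOrderIso := e.toOrderIso.symm
  rel_iff a b := by
    rw [← e.rel_iff, e.toOrderIso.apply_symm_apply, e.toOrderIso.apply_symm_apply]
  mem_bounded_iff a := by rw [← e.mem_bounded_iff, e.toOrderIso.apply_symm_apply]

theorem ll_iff (e : ContactIso L M) (a b : A) :
    M.ll (e.toOrderIso a) (e.toOrderIso b) ↔ L.ll a b := by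
  rw [LocalContact.ll, NonTangential, ← map_compl' e.toOrderIso, e.rel_iff]
  rfl

end BooleanAlgebra

variable {A B : MDHLC.{u}}

/-- The morphism `a ↦ I_{e a}` induced by an isomorphism `e` of the underlying local contact
algebras. -/
def toHom (e : ContactIso A.loc B.loc) : MDHLC.Hom A B where
  toFun a := DeltaIdeal.principal B.loc (e.toOrderIso a)
  map_inf a b := by
    rw [e.toOrderIso.map_inf]
    exact (MDHLC.Hom.id B).map_inf _ _
  map_eq_iSup a := by
    refine ((MDHLC.Hom.id B).map_eq_iSup (e.toOrderIso a)).trans ?_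
    rw [← e.toOrderIso.surjective.iSup_comp]
    simp only [mem_ofPred_eq, e.mem_bounded_iff, e.ll_iff]
    rfl
  map_bot := by
    rw [e.toOrderIso.map_bot]
    exact (MDHLC.Hom.id B).map_bot
  map_sup_le a₁ h₁ a₂ h₂ b₁ k₁ b₂ k₂ hab₁ hab₂ := by
    rw [e.toOrderIso.map_sup]
    exact (MDHLC.Hom.id B).map_sup_le _ ((e.mem_bounded_iff _).2 h₁) _ ((e.mem_bounded_iff _).2 h₂)
      _ ((e.mem_bounded_iff _).2 k₁) _ ((e.mem_bounded_iff _).2 k₂)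
      ((e.ll_iff _ _).2 hab₁) ((e.ll_iff _ _).2 hab₂)
  exists_mem b hb := by
    obtain ⟨c, hc, hbc⟩ := (MDHLC.Hom.id B).exists_mem b hb
    obtain ⟨a, rfl⟩ := e.toOrderIso.surjective c
    exact ⟨a, (e.mem_bounded_iff a).1 hc, hbc⟩

theorem toHom_comp_toHom_symm (e : ContactIso A.loc B.loc) :
    MDHLC.Hom.comp e.toHom e.symm.toHom = MDHLC.Hom.id A :=
  MDHLC.Hom.ext fun a => (e.symm.toHom.map_eq_iSup (e.toOrderIso a)).symm.trans <|
    congrArg (DeltaIdeal.principal A.loc) (e.toOrderIso.symm_apply_apply a)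

/-- The isomorphism of complete local contact algebras given by an isomorphism of the underlying
local contact algebras. -/
def toIso (e : ContactIso A.loc B.loc) : A ≅ B where
  hom := e.toHom
  inv := e.symm.toHom
  hom_inv_id := e.toHom_comp_toHom_symm
  inv_hom_id := e.symm.toHom_comp_toHom_symm

end ContactIso

namespace ContactEnd

section CompleteBooleanAlgebra

variable {B : Type*} [CompleteBooleanAlgebra B] (L : LocalContact B)

theorem exists_basic_eq {s : Set (ContactEnd L)} (hs : interior (closure s) = s) :
    ∃ a, basic L a = s := by
  refine ⟨sSup {b | basic L b ⊆ s}, Subset.antisymm ?_ fun x hx => ?_⟩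
  · refine (interior_maximal (fun x hx => mem_closure_iff_nhds.2 fun t ht => ?_)
      (isOpen_basic _)).trans hs.subset
    obtain ⟨c, hc, hct⟩ := exists_basic_subset ht
    obtain ⟨b, hb, hbc⟩ : ∃ b, basic L b ⊆ s ∧ c ⊓ b ≠ ⊥ := by
      by_contra! h
      have hdisj : Disjoint c (sSup {b | basic L b ⊆ s}) :=
        disjoint_sSup_iff.2 fun b hb => disjoint_iff.2 (h b hb)
      exact notMem_of_disjoint hdisj hc hx
    obtain ⟨y, hy⟩ := exists_mem (L := L) hbc
    obtain ⟨hyc, hyb⟩ := inf_mem_iff.1 hy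
    exact ⟨y, hct hyc, hb hyb⟩
  · have hs_open : IsOpen s := hs ▸ isOpen_interior
    obtain ⟨a, ha, has⟩ := exists_basic_subset (hs_open.mem_nhds hx)
    exact mem_of_le (le_sSup has) ha

theorem basicRegular_surjective : Function.Surjective (basicRegular L) := fun U => by
  obtain ⟨a, ha⟩ := exists_basic_eq L U.interior_closure
  exact ⟨a, SetLike.coe_injective ((coe_basicRegular a).trans ha)⟩

/-- A complete local contact algebra is isomorphic to the algebra of regular open subsets of its
dual space. -/
noncomputable def contactIso : ContactIso L (RegularOpens.localContact (ContactEnd L)) where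
  toOrderIso := RelIso.ofSurjective
    (OrderEmbedding.ofMapLEIff (basicRegular L) fun a b => by
      rw [← SetLike.coe_subset_coe, coe_basicRegular, coe_basicRegular, basic_subset_basic])
    (basicRegular_surjective L)
  rel_iff a b := by
    change RegularOpens.Contact (basicRegular L a) (basicRegular L b) ↔ _
    rw [RegularOpens.Contact, coe_basicRegular, coe_basicRegular,
      closure_inter_closure_basic_nonempty_iff]
  mem_bounded_iff a := by
    change basicRegular L a ∈ RegularOpens.relativelyCompact _ ↔ _
    rw [RegularOpens.mem_relativelyCompact, coe_basicRegular, isCompact_closure_basic_iff]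

end CompleteBooleanAlgebra

end ContactEnd

/-! ### The duality -/

namespace HLC

open RegularOpens

instance (X : HLC.{u}) : T2Space X.obj := X.property.1

instance (X : HLC.{u}) : LocallyCompactSpace X.obj := X.property.2

/-- The contravariant functor that sends a locally compact Hausdorff space to its algebra of regular
open subsets. -/
def regularOpens : HLC.{u}ᵒᵖ ⥤ MDHLC.{u} where
  obj X := algebra X.unop.obj
  map f := comap f.unop.hom.hom
  map_id _ := MDHLC.Hom.ext fun V => (principal_eq_idealOf V).symm
  map_comp f g := MDHLC.Hom.ext fun V =>
    idealOf_comap_eq_iSup g.unop.hom.hom (Opens.comap f.unop.hom.hom (toOpens V))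

instance : regularOpens.{u}.Faithful where
  map_injective h := Quiver.Hom.unop_inj <| by
    ext x
    exact congrArg (fun k => k x) (comap_injective h)

instance : regularOpens.{u}.Full where
  map_surjective φ := by
    obtain ⟨f, hf⟩ := comap_surjective φ
    exact ⟨(ObjectProperty.homMk (TopCat.ofHom f)).op, hf⟩

/-- The dual space of a complete local contact algebra. -/
def dualSpace (A : MDHLC.{u}) : HLC.{u} where
  obj := TopCat.of (ContactEnd A.loc)
  property := ⟨inferInstanceAs (T2Space (ContactEnd A.loc)),
    inferInstanceAs (LocallyCompactSpace (ContactEnd A.loc))⟩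

instance : regularOpens.{u}.EssSurj where
  mem_essImage A := ⟨Opposite.op (dualSpace A),
    ⟨(ContactIso.toIso (B := algebra (ContactEnd A.loc)) (ContactEnd.contactIso A.loc)).symm⟩⟩

instance : regularOpens.{u}.IsEquivalence where

end HLC

theorem theorem3p10 : Nonempty (HLC.{u}ᵒᵖ ≌ MDHLC.{u}) :=
  ⟨HLC.regularOpens.asEquivalence⟩
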